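/- **Model.** Let $N\ge 1$ respondents answer $J$ items at $T\ge 1$ time points; $Y_{nj}^t\in\{0,\dots,M_j-1\}$ is the response of respondent $n$ to item $j$ at time $t$, $X_n^t\in\mathbb R^{1\times D}$ is a known covariate vector, and $\alpha_n^t\in A_L=\{0,\dots,L-1\}^K$ is a latent state. For $\alpha,h\in A_L$ put $d(\alpha)_h=\prod_{k=1}^K I(\alpha_k\ge h_k)$. Let $d^{\mathrm m}(\alpha)$ be the subvector of $d(\alpha)$ given by a fixed set $\mathcal H\subseteq A_L$ of indices, and $d^{\mathrm s}(\alpha)$ the subvector given by the indices $h$ with at most $r$ nonzero coordinates, for a fixed $r$ (the order of the transition model). The parameter is $\theta=(\kappa,\beta,\gamma,\lambda,\xi,R)$, where $-\infty=\kappa_{j0}<\kappa_{j1}=0<\kappa_{j2}<\dots<\kappa_{jM_j}=\infty$ for each $j$ and $-\infty=\gamma_{k0}<\gamma_{k1}=0<\gamma_{k2}<\dots<\gamma_{kL}=\infty$ for each $k$; $\beta_j\in\mathbb R^{\mathcal H}$ satisfies the monotonicity condition that $u\ge v$ coordinatewise implies $d^{\mathrm m}(u)\beta_j\ge d^{\mathrm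 m}(v)\beta_j$; $\lambda$ and $\xi$ are real matrices with $K$ columns; and $R$ is a positive definite $K\times K$ correlation matrix. The respondents are independent. For each respondent, $(\alpha_n^t)_t$ is a Markov chain with $$p(\alpha_n^1=\alpha\mid\theta)=\mathbb P\bigl(Z\in G_\alpha\bigr),\quad Z\sim N_K(X_n^1\lambda,R),\qquad p(\alpha_n^t=\alpha\mid\alpha_n^{t-1}=\alpha',\theta)=\mathbb P\bigl(Z\in G_\alpha\bigr),\quad Z\sim N_K(X_n^t\lambda+d^{\mathrm s}(\alpha')\xi,R)\quad(t\ge2),$$ where $G_\alpha=\prod_{k}(\gamma_{k,\alpha_k},\gamma_{k,\alpha_k+1}]$; and, given the latent states, the responses are independent over $t$ and $j$ with $$p(Y_{nj}^t=m\mid\alpha_n^t=\alpha,\theta)=\Phi(\kappa_{j,m+1}-d^{\mathrm m}(\alpha)\beta_j)-\Phi(\kappa_{j,m}-d^{\mathrm m}(\alpha)\beta_j).$$ Let $B=B(\theta)$ be the $(\sum_jM_j)\times L^K$ emissions matrix with these entries (rows $(j,m)$, columns $\alpha$); let $U=U(\theta)$ be the family of the $L^K\times L^K$ transition matrices $U_{n,t,t-1}=(p(\alpha_n^t\mid\alpha_n^{t-1},\theta))$,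 $n\le N$, $2\le t\le T$; let $P=P(\theta)$ be the family of the marginal probability vectors $\pi_n^t=(p(\alpha_n^t\mid\theta))$, $n\le N$, $t\le T$; and let $p(Y\mid\theta)$ be the probability mass function of the full array of responses $Y=(Y_{nj}^t)$. **Conditions.** Let $\Theta$ be the set of all $\theta$ as above for which (C1) all entries of all $\pi_n^t$ are positive; (C2) $\sum_jM_j\ge L^K$; (C3) there are pairwise disjoint sets $J_1,J_2,J_3$ of items such that each of the three blocks of $B$ formed by the rows belonging to $J_1$, $J_2$, $J_3$ has rank $L^K$; (C4) every $U_{n,t,t-1}$ has rank $L^K$. **Statement.** The triple $(B,U,P)$ is strictly identifiable from $\{p(Y\mid\theta):\theta\in\Theta\}$ up to label swapping: if $\theta,\widetilde\theta\in\Theta$ and $p(Y=y\mid\theta)=p(Y=y\mid\widetilde\theta)$ for all $y$, then there is a single permutation $\sigma$ of the set $A_L$ of latent states such that, for all $n$, $t$, $j$, $m$ and all $\alpha,\alpha'\in A_L$, $$\widetilde B_{(j,m),\alpha}=B_{(j,m),\sigma(\alpha)},\qquad (\widetilde U_{n,t,t-1})_{\alpha',\alpha}=(U_{n,t,t-1})_{\sigma(\alpha'),\sigma(\alpha)}\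 (t\ge2),\qquad \widetilde\pi_n^t(\alpha)=\pi_n^t(\sigma(\alpha)).$$ -/

import Mathlib

open MeasureTheory ProbabilityTheory

/-- The set `A_L = {0, …, L - 1}^K` of latent states (attribute profiles). -/
abbrev LatentState (K L : ℕ) : Type := Fin K → Fin L

/-- The observed, non-random part of the longitudinal restricted latent class model.  The number of
time points is `T = S + 1`; the time points are indexed by `Fin (S + 1)`, the first one being `0`,
and the transition from time point `s.castSucc` to time point `s.succ` is indexed by `s : Fin S`. -/
structure LongitudinalDesign where
  /-- number of respondents -/
  N : ℕ
  /-- number of transitions, one less than the number of time points -/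
  S : ℕ
  /-- number of items -/
  J : ℕ
  /-- dimension of the latent state -/
  K : ℕ
  /-- number of levels of each dimension of the latent state -/
  L : ℕ
  /-- number of covariates -/
  D : ℕ
  /-- item `j` has the possible responses `0, …, M j - 1` -/
  M : Fin J → ℕ
  /-- the covariates: `X n t` is the covariate vector of respondent `n` at time point `t` -/
  X : Fin N → Fin (S + 1) → Fin D → ℝ
  /-- the components (effects) of the saturated design vector kept in the measurement model -/
  Hm : Finset (LatentState K L)
  /-- the order of the transition model -/
  otr : ℕ

/-- The component with index `h` of the cumulative coding
`d(α) = d_1(α) ⊗ ⋯ ⊗ d_K(α)`, where `d_k(α) = (I(α_k ≥ 0), …, I(α_k ≥ L - 1))`. -/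
def designVector {K L : ℕ} (α h : LatentState K L) : ℝ :=
  ∏ k, if h k ≤ α k then 1 else 0

/-- The components of the design vector that involve at most `r` dimensions of the latent state
(intercept, main effects, and interactions up to order `r`). -/
def orderComponents (K L r : ℕ) : Finset (LatentState K L) :=
  Finset.univ.filter fun h => (Finset.univ.filter fun k => (h k : ℕ) ≠ 0).card ≤ r

/-- The distribution function of the standard normal law, on the extended real line. -/
noncomputable def stdNormalCDF (c : EReal) : ℝ :=
  (gaussianReal 0 1).real {z : ℝ | (z : EReal) ≤ c}

/-- `c` is a vector of thresholds `-∞ = c 0 < c 1 = 0 < c 2 < ⋯ < c m = ∞`. -/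
def IsThreshold {m : ℕ} (c : Fin (m + 1) → EReal) : Prop :=
  StrictMono c ∧ ∀ i : Fin (m + 1),
    ((i : ℕ) = 0 → c i = ⊥) ∧ ((i : ℕ) = 1 → c i = 0) ∧ ((i : ℕ) = m → c i = ⊤)

namespace LongitudinalDesign

/-- The latent states of the model. -/
abbrev State (𝒟 : LongitudinalDesign) : Type := LatentState 𝒟.K 𝒟.L

/-- The row indices of the emissions matrix: pairs of an item and a response to it. -/
abbrev ItemResponse (𝒟 : LongitudinalDesign) : Type := Σ j : Fin 𝒟.J, Fin (𝒟.M j)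

/-- A data set: the response of every respondent at every time point to every item. -/
abbrev Data (𝒟 : LongitudinalDesign) : Type :=
  Fin 𝒟.N → Fin (𝒟.S + 1) → (j : Fin 𝒟.J) → Fin (𝒟.M j)

/-- The components of the design vector of the transition model. -/
abbrev Hs (𝒟 : LongitudinalDesign) : Finset 𝒟.State := orderComponents 𝒟.K 𝒟.L 𝒟.otr

/-- The parameters `θ = (θ_m, θ_s)`, with `θ_m = (κ, β)` and `θ_s = (γ, λ, ξ, R)`. -/
structure Param (𝒟 : LongitudinalDesign) where
  /-- thresholds of the measurement model -/
  κ : (j : Fin 𝒟.J) → Fin (𝒟.M j + 1) → EReal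
  /-- slopes of the measurement model -/
  β : Fin 𝒟.J → 𝒟.Hm → ℝ
  /-- thresholds of the structural model -/
  γ : Fin 𝒟.K → Fin (𝒟.L + 1) → EReal
  /-- slopes of the covariates in the structural model -/
  lam : Matrix (Fin 𝒟.D) (Fin 𝒟.K) ℝ
  /-- slopes of the previous latent state in the structural model -/
  ξ : Matrix 𝒟.Hs (Fin 𝒟.K) ℝ
  /-- correlation matrix of the structural model -/
  R : Matrix (Fin 𝒟.K) (Fin 𝒟.K) ℝ

namespace Param

variable {𝒟 : LongitudinalDesign} (θ : Param 𝒟)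

/-- The linear predictor `d(α) β_j` of item `j` in the latent state `α`. -/
noncomputable def itemPredictor (j : Fin 𝒟.J) (α : 𝒟.State) : ℝ :=
  ∑ h : 𝒟.Hm, designVector α h * θ.β j h

/-- The parameter space of the model: ordered thresholds, slopes of the measurement model that
satisfy the monotonicity condition, and a positive definite correlation matrix. -/
def IsValid : Prop :=
  (∀ j, IsThreshold (θ.κ j)) ∧
  (∀ j, ∀ u v : 𝒟.State, v ≤ u → θ.itemPredictor j v ≤ θ.itemPredictor j u) ∧
  (∀ k, IsThreshold (θ.γ k)) ∧
  θ.R.PosDef ∧ (∀ k, θ.R k k = 1)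

/-- The emissions matrix `B`, whose entry in row `(j, m)` and column `α` is
`p(Y_{nj}^t = m | α_n^t = α) = Φ(κ_{j,m+1} - d(α) β_j) - Φ(κ_{j,m} - d(α) β_j)`. -/
noncomputable def emission : Matrix 𝒟.ItemResponse 𝒟.State ℝ :=
  Matrix.of fun r α =>
    stdNormalCDF (θ.κ r.1 r.2.succ - (θ.itemPredictor r.1 α : EReal)) -
      stdNormalCDF (θ.κ r.1 r.2.castSucc - (θ.itemPredictor r.1 α : EReal))

/-- The multivariate probit probability of the latent state `α`: the probability that a
`N(μ, R)`-distributed vector has its coordinate `k` in `(γ_{k, α_k}, γ_{k, α_k + 1}]`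
for every `k`. -/
noncomputable def probit (μ : Fin 𝒟.K → ℝ) (α : 𝒟.State) : ℝ :=
  (multivariateGaussian (WithLp.toLp 2 μ) θ.R).real
    {x | ∀ k, θ.γ k (α k).castSucc < (x k : EReal) ∧ (x k : EReal) ≤ θ.γ k (α k).succ}

/-- The initial probabilities `p(α_n^1 | θ_s)` of the latent state of respondent `n`. -/
noncomputable def initial (n : Fin 𝒟.N) (α : 𝒟.State) : ℝ :=
  θ.probit (fun k => ∑ i, 𝒟.X n 0 i * θ.lam i k) α

/-- The transition matrix `U_{n, t, t-1}` of respondent `n` from time point `s.castSucc` to time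
point `s.succ`; its rows are indexed by the previous state, its columns by the new state. -/
noncomputable def transition (n : Fin 𝒟.N) (s : Fin 𝒟.S) : Matrix 𝒟.State 𝒟.State ℝ :=
  Matrix.of fun α' α => θ.probit
    (fun k => ∑ i, 𝒟.X n s.succ i * θ.lam i k + ∑ h : 𝒟.Hs, designVector α' h * θ.ξ h k) α

/-- The probability of the path `a` of latent states of respondent `n`. -/
noncomputable def pathProb (n : Fin 𝒟.N) (a : Fin (𝒟.S + 1) → 𝒟.State) : ℝ :=
  θ.initial n (a 0) * ∏ s : Fin 𝒟.S, θ.transition n s (a s.castSucc) (a s.succ)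

/-- The marginal probabilities `π_n^t = (p(α_n^t | θ_s))` of the latent state of respondent `n`
at time point `t`. -/
noncomputable def marginal (n : Fin 𝒟.N) (t : Fin (𝒟.S + 1)) (α : 𝒟.State) : ℝ :=
  ∑ a : Fin (𝒟.S + 1) → 𝒟.State, if a t = α then θ.pathProb n a else 0

/-- The probability `p(Y = y | θ)` of the full data set `y`: the respondents are independent, and
given the latent states of a respondent, the responses of this respondent are independent over
time points and items. -/
noncomputable def responseProb (y : 𝒟.Data) : ℝ :=
  ∏ n, ∑ a : Fin (𝒟.S + 1) → 𝒟.State,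
    θ.pathProb n a * ∏ t, ∏ j, θ.emission ⟨j, y n t j⟩ (a t)

/-- The rows of the emissions matrix that belong to the items in `I`. -/
noncomputable def emissionBlock (I : Finset (Fin 𝒟.J)) :
    Matrix {r : 𝒟.ItemResponse // r.1 ∈ I} 𝒟.State ℝ :=
  θ.emission.submatrix Subtype.val id

/-- Condition (C1): all marginal probabilities of the latent states are positive. -/
def C1 : Prop := ∀ n t α, 0 < θ.marginal n t α

/-- Condition (C3): there are three disjoint sets of items such that each of the three
corresponding blocks of the emissions matrix has rank `L ^ K`. -/
def C3 : Prop :=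
  ∃ I₁ I₂ I₃ : Finset (Fin 𝒟.J), Disjoint I₁ I₂ ∧ Disjoint I₁ I₃ ∧ Disjoint I₂ I₃ ∧
    (θ.emissionBlock I₁).rank = 𝒟.L ^ 𝒟.K ∧
    (θ.emissionBlock I₂).rank = 𝒟.L ^ 𝒟.K ∧
    (θ.emissionBlock I₃).rank = 𝒟.L ^ 𝒟.K

/-- Condition (C4): all transition matrices have full rank. -/
def C4 : Prop := ∀ n s, (θ.transition n s).rank = 𝒟.L ^ 𝒟.K

end Param

/-- Condition (C2): the total number of item responses is at least the number of latent states. -/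
def C2 (𝒟 : LongitudinalDesign) : Prop := 𝒟.L ^ 𝒟.K ≤ ∑ j, 𝒟.M j

/-- The set of the parameters that satisfy the conditions (C1) to (C4). -/
def paramSpace (𝒟 : LongitudinalDesign) : Set (Param 𝒟) :=
  {θ | θ.IsValid ∧ θ.C1 ∧ 𝒟.C2 ∧ θ.C3 ∧ θ.C4}

/-- A triple `(B, U, P)` of an emissions matrix, a family of transition matrices (one for each
respondent and each transition) and a family of vectors of latent state probabilities (one for
each respondent and each time point). -/
@[ext]
structure Triple (𝒟 : LongitudinalDesign) where
  /-- the emissions matrix -/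
  B : Matrix 𝒟.ItemResponse 𝒟.State ℝ
  /-- the transition matrices -/
  U : Fin 𝒟.N → Fin 𝒟.S → Matrix 𝒟.State 𝒟.State ℝ
  /-- the marginal latent state probabilities -/
  P : Fin 𝒟.N → Fin (𝒟.S + 1) → 𝒟.State → ℝ

/-- The triple `(B, U, P)` that belongs to the parameter `θ`. -/
noncomputable def Param.triple {𝒟 : LongitudinalDesign} (θ : Param 𝒟) : Triple 𝒟 where
  B := θ.emission
  U := θ.transition
  P := θ.marginal

/-- Relabelling of the latent states by the permutation `σ`: the columns of the emissions matrix,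
the rows and the columns of all the transition matrices, and the entries of all the vectors of
latent state probabilities are permuted by the same `σ`. -/
def Triple.relabel {𝒟 : LongitudinalDesign} (σ : Equiv.Perm 𝒟.State) (x : Triple 𝒟) :
    Triple 𝒟 where
  B := x.B.submatrix id σ
  U := fun n s => (x.U n s).submatrix σ σ
  P := fun n t α => x.P n t (σ α)

/-- Equality up to label swapping. -/
def labelSwap (𝒟 : LongitudinalDesign) : Setoid (Triple 𝒟) where
  r x x' := ∃ σ : Equiv.Perm 𝒟.State, x' = x.relabel σ
  iseqv :=
    { refl := fun _ => ⟨1, rfl⟩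
      symm := by
        rintro x x' ⟨σ, rfl⟩
        refine ⟨σ⁻¹, ?_⟩
        ext <;> simp [Triple.relabel]
      trans := by
        rintro x x' x'' ⟨σ, rfl⟩ ⟨τ, rfl⟩
        exact ⟨σ * τ, rfl⟩ }

end LongitudinalDesign

/-- The quantity `g θ` is strictly identifiable, up to the equivalence relation `E`, from the
family `{f(· | θ) ; θ ∈ Θ}` of probability mass functions: equal members of the family have
equivalent quantities.  For `g = id` this is strict identifiability of `Θ`. -/
def StrictlyIdentifiable {A Q Y : Type*} (Θ : Set A) (g : A → Q) (E : Setoid Q)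
    (f : A → Y → ℝ) : Prop :=
  ∀ θ ∈ Θ, ∀ θ' ∈ Θ, (∀ y, f θ y = f θ' y) → E (g θ) (g θ')

/-! Fix a respondent and a time point. The moments of one, two or three distinct items are averages
of products of emission entries under the marginal law `π`. This is a three-way table, treated as in
Kruskal's theorem in the easy case where every factor has full column rank. Write `A₁`, `A₂`, `A₃`
for the three blocks and let `C₁`, `C₂` be left inverses of the first two. With `G = C₁ A₁'` and `H
= C₂ A₂'`, the two-way moments give `G diag(π') Hᵀ = diag(π)`. As `π > 0`, `G` is invertible. The
three-way moments then give `G diag(v') = diag(v) G` for every row `v` of `A₃` and the matching row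
`v'` of `A₃'`. A nonzero entry of `G` thus matches a column of `A₃'` with a column of `A₃`. The
columns of `A₃` are distinct, so `G` is a permutation matrix up to scaling, and so is `H`, with the
same permutation. The one-way moments remove the scaling (`exists_perm_of_three_way`).

The permutation could depend on the respondent and the time, but each one carries the same `B` to
the same `B'`. The columns of `B` are distinct, so all of them agree. The moments of two consecutive
times are the entries of `B W Bᵀ` with `W = diag(π) U`. A left inverse of a block of `B` recovers
`W`, and dividing by `π > 0` recovers `U` under the same permutation. -/

/-! ### Linear algebra and three-way tables -/

/-- A matrix of full column rank has a left inverse. -/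
theorem exists_left_inverse_of_rank_eq_card {R S : Type*} [Fintype R] [Fintype S] [DecidableEq S]
    (A : Matrix R S ℝ) (h : A.rank = Fintype.card S) : ∃ C : Matrix S R ℝ, C * A = 1 := by
  classical
  have hker : LinearMap.ker A.mulVecLin = ⊥ := by
    have := LinearMap.finrank_range_add_finrank_ker A.mulVecLin
    rw [Module.finrank_fintype_fun_eq_card] at this
    rw [Matrix.rank] at h
    exact Submodule.finrank_eq_zero.mp (by omega)
  obtain ⟨g, hg⟩ := LinearMap.exists_leftInverse_of_injective _ hker
  refine ⟨LinearMap.toMatrix' g, ?_⟩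
  have := congrArg LinearMap.toMatrix' hg
  rw [LinearMap.toMatrix'_comp, LinearMap.toMatrix'_id] at this
  rwa [← Matrix.toLin'_apply', LinearMap.toMatrix'_toLin'] at this

/-- The columns of a matrix with a left inverse are distinct. -/
theorem column_injective_of_left_inverse {R S : Type*} [Fintype R] [DecidableEq S]
    {A : Matrix R S ℝ} {C : Matrix S R ℝ} (h : C * A = 1) {a b : S}
    (hab : ∀ r, A r a = A r b) : a = b := by
  by_contra hne
  have h1 : (C * A) a a = (C * A) a b := by simp [Matrix.mul_apply, hab]
  rw [h, Matrix.one_apply_eq, Matrix.one_apply_ne hne] at h1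
  exact one_ne_zero h1

/-- If `G diag(p') Hᵀ = diag(p)` with `p` positive, then `diag(p') Hᵀ diag(p)⁻¹` is a right inverse
of `G`. -/
theorem mul_eq_one_of_factor {S : Type*} [Fintype S] [DecidableEq S] {G H : Matrix S S ℝ}
    {p p' : S → ℝ} (hp : ∀ a, 0 < p a)
    (h : ∀ a b, ∑ c, G a c * p' c * H b c = if a = b then p a else 0) :
    G * (Matrix.of fun c b => p' c * H b c / p b) = 1 := by
  ext a b
  have : (G * (Matrix.of fun c b => p' c * H b c / p b)) a b
      = (∑ c, G a c * p' c * H b c) / p b := by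
    simp only [Matrix.mul_apply, Matrix.of_apply, Finset.sum_div]
    exact Finset.sum_congr rfl fun c _ => by ring
  rw [this, h, Matrix.one_apply]
  split_ifs with hab
  · rw [hab, div_self (hp b).ne']
  · simp

/-- If `G diag(p') Hᵀ = diag(p)` and `G diag(p' v') Hᵀ = diag(p v)`, then
`G diag(v') = diag(v) G`. -/
theorem diagonal_comm_of_factor {S : Type*} [Fintype S] [DecidableEq S] {G H : Matrix S S ℝ}
    {p p' v v' : S → ℝ} (hp : ∀ a, 0 < p a)
    (h : ∀ a b, ∑ c, G a c * p' c * H b c = if a = b then p a else 0)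
    (hv : ∀ a b, ∑ c, G a c * (p' c * v' c) * H b c = if a = b then p a * v a else 0) (a b : S) :
    G a b * v' b = v a * G a b := by
  set X : Matrix S S ℝ := Matrix.of fun c b => p' c * H b c / p b
  have hGX : G * X = 1 := mul_eq_one_of_factor hp h
  have hGvX : G * Matrix.diagonal v' * X = Matrix.diagonal v := by
    ext a b
    have : (G * Matrix.diagonal v' * X) a b
        = (∑ c, G a c * (p' c * v' c) * H b c) / p b := by
      rw [Matrix.mul_apply]
      simp only [Matrix.mul_diagonal, X, Matrix.of_apply, Finset.sum_div]
      exact Finset.sum_congr rfl fun c _ => by ring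
    rw [this, hv, Matrix.diagonal_apply]
    split_ifs with hab
    · rw [hab]; field_simp [(hp b).ne']
    · simp
  -- A one-sided inverse of a square matrix is two-sided; this lets `X` be cancelled.
  have hXG : X * G = 1 := mul_eq_one_comm.mp hGX
  have key : G * Matrix.diagonal v' = Matrix.diagonal v * G := by
    rw [← hGvX, Matrix.mul_assoc _ X G, hXG, Matrix.mul_one]
  have := congrFun (congrFun key a) b
  rwa [Matrix.mul_diagonal, Matrix.diagonal_mul] at this

/-- If `G diag(p') Hᵀ = diag(p)` with `p` positive, then every row and every column of `G` has a
nonzero entry. -/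
theorem exists_ne_zero_of_factor {S : Type*} [Fintype S] [DecidableEq S] {G H : Matrix S S ℝ}
    {p p' : S → ℝ} (hp : ∀ a, 0 < p a)
    (h : ∀ a b, ∑ c, G a c * p' c * H b c = if a = b then p a else 0) :
    (∀ a, ∃ b, G a b ≠ 0) ∧ ∀ b, ∃ a, G a b ≠ 0 := by
  set X : Matrix S S ℝ := Matrix.of fun c b => p' c * H b c / p b
  have hGX : G * X = 1 := mul_eq_one_of_factor hp h
  have hXG : X * G = 1 := mul_eq_one_comm.mp hGX
  constructor
  · intro a
    by_contra! h0
    have := congrFun (congrFun hGX a) a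
    simp [Matrix.mul_apply, h0] at this
  · intro b
    by_contra! h0
    have := congrFun (congrFun hXG b) b
    simp [Matrix.mul_apply, h0] at this

/-- Uniqueness of the decomposition of a three-way table into products: the two weightings are
related by a permutation, which also relates any two functions with the same moments against
one of the first two factors. -/
theorem exists_perm_of_three_way {R₁ R₂ R₃ S : Type*} [Fintype R₁] [Fintype R₂] [Fintype S]
    [DecidableEq S] {A₁ A₁' : Matrix R₁ S ℝ} {A₂ A₂' : Matrix R₂ S ℝ} {A₃ A₃' : Matrix R₃ S ℝ}
    {p p' : S → ℝ} {C₁ : Matrix S R₁ ℝ} {C₂ : Matrix S R₂ ℝ} (hC₁ : C₁ * A₁ = 1)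
    (hC₂ : C₂ * A₂ = 1) (hA₃ : ∀ a b, (∀ r, A₃ r a = A₃ r b) → a = b) (hp : ∀ a, 0 < p a)
    (h₁ : ∀ r, ∑ a, p a * A₁ r a = ∑ a, p' a * A₁' r a)
    (h₂ : ∀ r, ∑ a, p a * A₂ r a = ∑ a, p' a * A₂' r a)
    (h₁₂ : ∀ r s, ∑ a, p a * (A₁ r a * A₂ s a) = ∑ a, p' a * (A₁' r a * A₂' s a))
    (h₁₂₃ : ∀ r s q, ∑ a, p a * (A₁ r a * (A₂ s a * A₃ q a))
      = ∑ a, p' a * (A₁' r a * (A₂' s a * A₃' q a))) :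
    ∃ σ : Equiv.Perm S, (∀ b, p' b = p (σ b)) ∧
      ∀ u u' : S → ℝ, ((∀ r, ∑ a, p a * (u a * A₁ r a) = ∑ a, p' a * (u' a * A₁' r a)) ∨
        (∀ r, ∑ a, p a * (u a * A₂ r a) = ∑ a, p' a * (u' a * A₂' r a))) →
        ∀ b, u' b = u (σ b) := by
  set G := C₁ * A₁'
  set H := C₂ * A₂'
  have hC₁' : ∀ a b, ∑ r, C₁ a r * A₁ r b = if a = b then 1 else 0 := fun a b => by
    rw [← Matrix.mul_apply, hC₁, Matrix.one_apply]
  have hC₂' : ∀ a b, ∑ r, C₂ a r * A₂ r b = if a = b then 1 else 0 := fun a b => by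
    rw [← Matrix.mul_apply, hC₂, Matrix.one_apply]
  -- Applying `C₁` to moments against `A₁` isolates a single state `a`.
  have e₁ : ∀ u u' : S → ℝ, (∀ r, ∑ a, p a * (u a * A₁ r a) = ∑ a, p' a * (u' a * A₁' r a)) →
      ∀ a, p a * u a = ∑ c, p' c * u' c * G a c := by
    intro u u' h a
    have h1 : ∑ r, C₁ a r * ∑ b, p b * (u b * A₁ r b)
        = ∑ r, C₁ a r * ∑ b, p' b * (u' b * A₁' r b) :=
      Finset.sum_congr rfl fun r _ => by rw [h]
    have aux : ∀ (q w : S → ℝ) (A : Matrix R₁ S ℝ), ∑ r, C₁ a r * ∑ b, q b * (w b * A r b)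
        = ∑ b, q b * w b * ∑ r, C₁ a r * A r b := by
      intro q w A
      simp only [Finset.mul_sum]
      rw [Finset.sum_comm]
      exact Finset.sum_congr rfl fun _ _ => Finset.sum_congr rfl fun _ _ => by ring
    rw [aux, aux] at h1
    simpa [hC₁', G, Matrix.mul_apply] using h1
  have e₂ : ∀ u u' : S → ℝ, (∀ r, ∑ a, p a * (u a * A₂ r a) = ∑ a, p' a * (u' a * A₂' r a)) →
      ∀ a, p a * u a = ∑ c, p' c * u' c * H a c := by
    intro u u' h a
    have h1 : ∑ r, C₂ a r * ∑ b, p b * (u b * A₂ r b)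
        = ∑ r, C₂ a r * ∑ b, p' b * (u' b * A₂' r b) :=
      Finset.sum_congr rfl fun r _ => by rw [h]
    have aux : ∀ (q w : S → ℝ) (A : Matrix R₂ S ℝ), ∑ r, C₂ a r * ∑ b, q b * (w b * A r b)
        = ∑ b, q b * w b * ∑ r, C₂ a r * A r b := by
      intro q w A
      simp only [Finset.mul_sum]
      rw [Finset.sum_comm]
      exact Finset.sum_congr rfl fun _ _ => Finset.sum_congr rfl fun _ _ => by ring
    rw [aux, aux] at h1
    simpa [hC₂', H, Matrix.mul_apply] using h1
  have e₁₂ : ∀ v v' : S → ℝ, (∀ r s, ∑ a, p a * (A₁ r a * (A₂ s a * v a))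
      = ∑ a, p' a * (A₁' r a * (A₂' s a * v' a))) →
      ∀ a b, ∑ c, G a c * (p' c * v' c) * H b c = if a = b then p a * v a else 0 := by
    intro v v' h a b
    have h1 : ∀ s, p a * (A₂ s a * v a) = ∑ c, p' c * (A₂' s c * v' c) * G a c := fun s =>
      e₁ (fun a => A₂ s a * v a) (fun a => A₂' s a * v' a) (fun r => by
        convert h r s using 2 <;> ring) a
    -- With `a` fixed, the identity in `s` is again a family of moments against `A₂`: on one side of
    -- `v a` times the point mass at `a`, on the other of `v'` times row `a` of `G`.
    have h2 := e₂ (fun c => if c = a then v a else 0) (fun c => v' c * G a c) (fun s => by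
      have := h1 s
      simp only [ite_mul, mul_ite, zero_mul, mul_zero, Finset.sum_ite_eq', Finset.mem_univ,
        if_true]
      rw [mul_comm (v a), this]
      exact Finset.sum_congr rfl fun c _ => by ring) b
    rw [show (if a = b then p a * v a else 0) = p b * if b = a then v a else 0 by
      by_cases hab : a = b
      · simp [hab]
      · simp [hab, Ne.symm hab], h2]
    exact Finset.sum_congr rfl fun c _ => by ring
  have hGH : ∀ a b, ∑ c, G a c * p' c * H b c = if a = b then p a else 0 := by
    intro a b
    simpa using e₁₂ (fun _ => 1) (fun _ => 1) (by simpa only [mul_one] using h₁₂) a b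
  have hHG : ∀ a b, ∑ c, H a c * p' c * G b c = if a = b then p a else 0 := by
    intro a b
    rw [show (if a = b then p a else 0) = if b = a then p b else 0 by
      by_cases hab : a = b
      · simp [hab]
      · simp [hab, Ne.symm hab], ← hGH]
    exact Finset.sum_congr rfl fun c _ => by ring
  have hGv := fun q => e₁₂ (A₃ q) (A₃' q) fun r s => h₁₂₃ r s q
  have hHv : ∀ q a b, ∑ c, H a c * (p' c * A₃' q c) * G b c
      = if a = b then p a * A₃ q a else 0 := by
    intro q a b
    rw [show (if a = b then p a * A₃ q a else 0) = if b = a then p b * A₃ q b else 0 by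
      by_cases hab : a = b
      · simp [hab]
      · simp [hab, Ne.symm hab], ← hGv]
    exact Finset.sum_congr rfl fun c _ => by ring
  have hG0 : ∀ a b, G a b ≠ 0 → ∀ q, A₃' q b = A₃ q a := fun a b hab q =>
    mul_left_cancel₀ hab ((diagonal_comm_of_factor hp hGH (hGv q) a b).trans (mul_comm _ _))
  have hH0 : ∀ a b, H a b ≠ 0 → ∀ q, A₃' q b = A₃ q a := fun a b hab q =>
    mul_left_cancel₀ hab ((diagonal_comm_of_factor hp hHG (hHv q) a b).trans (mul_comm _ _))
  obtain ⟨hrow, hcol⟩ := exists_ne_zero_of_factor hp hGH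
  -- `s b` is a row in which column `b` of `G` is nonzero; distinctness of the columns of `A₃` makes
  -- it the only one, for `H` as well.
  choose s hs using hcol
  have hGs : ∀ a b, G a b ≠ 0 → a = s b := fun a b hab =>
    hA₃ _ _ fun q => by rw [← hG0 a b hab, hG0 _ b (hs b)]
  have hHs : ∀ a b, H a b ≠ 0 → a = s b := fun a b hab =>
    hA₃ _ _ fun q => by rw [← hH0 a b hab, hG0 _ b (hs b)]
  have hsurj : Function.Surjective s := fun a => by
    obtain ⟨b, hb⟩ := hrow a
    exact ⟨b, (hGs a b hb).symm⟩
  have hbij : Function.Bijective s := Finite.surjective_iff_bijective.mp hsurj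
  have f₁ : ∀ u u' : S → ℝ, (∀ r, ∑ a, p a * (u a * A₁ r a) = ∑ a, p' a * (u' a * A₁' r a)) →
      ∀ b, p (s b) * u (s b) = p' b * u' b * G (s b) b := by
    intro u u' h b
    rw [e₁ u u' h]
    refine Finset.sum_eq_single b (fun c _ hc => ?_) (by simp)
    rw [show G (s b) c = 0 by
      by_contra h0
      exact hc (hbij.1 (hGs _ _ h0)).symm, mul_zero]
  have f₂ : ∀ u u' : S → ℝ, (∀ r, ∑ a, p a * (u a * A₂ r a) = ∑ a, p' a * (u' a * A₂' r a)) →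
      ∀ b, p (s b) * u (s b) = p' b * u' b * H (s b) b := by
    intro u u' h b
    rw [e₂ u u' h]
    refine Finset.sum_eq_single b (fun c _ hc => ?_) (by simp)
    rw [show H (s b) c = 0 by
      by_contra h0
      exact hc (hbij.1 (hHs _ _ h0)).symm, mul_zero]
  -- The one-way moments, together with the diagonal entries of `G diag(p') Hᵀ`, force the scaling
  -- to be 1.
  have g₁ : ∀ b, p (s b) = p' b * G (s b) b := by simpa using f₁ (fun _ => 1) (fun _ => 1) (by simpa only [one_mul] using h₁)
  have g₂ : ∀ b, p (s b) = p' b * H (s b) b := by simpa using f₂ (fun _ => 1) (fun _ => 1) (by simpa only [one_mul] using h₂)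
  have g₁₂ : ∀ b, G (s b) b * p' b * H (s b) b = p (s b) := by
    intro b
    have := hGH (s b) (s b)
    rw [if_pos rfl] at this
    rw [← this]
    symm
    refine Finset.sum_eq_single b (fun c _ hc => ?_) (by simp)
    rw [show H (s b) c = 0 by
      by_contra h0
      exact hc (hbij.1 (hHs _ _ h0)).symm, mul_zero]
  refine ⟨Equiv.ofBijective s hbij, fun b => ?_, fun u u' h b => ?_⟩
  · have hH1 : H (s b) b = 1 := by
      have := g₁₂ b
      rw [mul_comm (G _ _), ← g₁] at this
      exact mul_left_cancel₀ (hp (s b)).ne' (this.trans (mul_one _).symm)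
    have := g₂ b
    rw [hH1, mul_one] at this
    exact this.symm
  · change u' b = u (s b)
    apply mul_left_cancel₀ (hp (s b)).ne'
    rcases h with h | h
    · rw [f₁ u u' h b, g₁ b]; ring
    · rw [f₂ u u' h b, g₂ b]; ring

/-! ### Path sums of Markov chains -/

/-- The weight of a path of a Markov chain with initial weights `p` and transitions `U`. -/
def markovWeight {A : Type*} {S : ℕ} (p : A → ℝ) (U : Fin S → Matrix A A ℝ)
    (a : Fin (S + 1) → A) : ℝ :=
  p (a 0) * ∏ s : Fin S, U s (a s.castSucc) (a s.succ)

theorem markovWeight_mul {A : Type*} {S : ℕ} (p f : A → ℝ) (U : Fin S → Matrix A A ℝ)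
    (a : Fin (S + 1) → A) :
    markovWeight p U a * f (a 0) = markovWeight (fun x => p x * f x) U a := by
  simp only [markovWeight]; ring

/-- Once the first state is fixed at `x`, the tail is a chain with unnormalised initial weights `p x
* U 0 x ·`. Allowing arbitrary real initial weights is what makes induction on the length possible.
-/
theorem sum_markovWeight_cons {A : Type*} [Fintype A] {S : ℕ} (p : A → ℝ)
    (U : Fin (S + 1) → Matrix A A ℝ) (F : (Fin (S + 2) → A) → ℝ) :
    ∑ a, markovWeight p U a * F a = ∑ x, ∑ a : Fin (S + 1) → A,
      markovWeight (fun y => p x * U 0 x y) (fun s => U s.succ) a * F (Fin.cons x a) := by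
  rw [← (Fin.consEquiv fun _ => A).sum_comp, Fintype.sum_prod_type]
  refine Finset.sum_congr rfl fun x _ => Finset.sum_congr rfl fun a _ => ?_
  change _ * F (Fin.cons x a) = _
  simp only [markovWeight, Fin.consEquiv_apply, Fin.prod_univ_succ (n := S), Fin.cons_zero,
    Fin.cons_succ, Fin.castSucc_zero, ← Fin.succ_castSucc]
  ring

/-- The total weight of all paths of a stochastic Markov chain. -/
theorem sum_markovWeight {A : Type*} [Fintype A] {S : ℕ} (p : A → ℝ) (U : Fin S → Matrix A A ℝ)
    (hU : ∀ s x, ∑ y, U s x y = 1) : ∑ a, markovWeight p U a = ∑ x, p x := by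
  induction S generalizing p with
  | zero =>
    rw [← (Equiv.funUnique (Fin 1) A).symm.sum_comp]
    simp [markovWeight]
  | succ S ih =>
    have := sum_markovWeight_cons p U fun _ => 1
    simp only [mul_one] at this
    rw [this]
    refine Finset.sum_congr rfl fun x _ => ?_
    rw [ih _ _ fun s => hU s.succ, ← Finset.mul_sum, hU, mul_one]

/-- The Markov property, in terms of sums over paths. -/
theorem sum_markovWeight_pair {A : Type*} [Fintype A] {S : ℕ} (p : A → ℝ)
    (U : Fin S → Matrix A A ℝ) (hU : ∀ s x, ∑ y, U s x y = 1) (s : Fin S) (f g : A → ℝ) :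
    ∑ a, markovWeight p U a * (f (a s.castSucc) * g (a s.succ))
      = ∑ a, markovWeight p U a * (f (a s.castSucc) * ∑ y, U s (a s.castSucc) y * g y) := by
  induction S generalizing p with
  | zero => exact s.elim0
  | succ S ih =>
    rw [sum_markovWeight_cons p U fun a => f (a s.castSucc) * g (a s.succ),
      sum_markovWeight_cons p U fun a => f (a s.castSucc) * ∑ y, U s (a s.castSucc) y * g y]
    refine Finset.sum_congr rfl fun x _ => ?_
    induction s using Fin.cases with
    | zero =>
      simp only [Fin.castSucc_zero, Fin.cons_zero, Fin.cons_succ]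
      -- At the first transition the test function depends on the tail only through its initial
      -- state, so it is absorbed into the initial weights.
      have h1 : ∀ a : Fin (S + 1) → A,
          markovWeight (fun y => p x * U 0 x y) (fun s => U s.succ) a * (f x * g (a 0))
            = markovWeight (fun y => p x * U 0 x y * (f x * g y)) (fun s => U s.succ) a :=
        fun a => markovWeight_mul _ (fun y => f x * g y) _ a
      simp only [h1]
      rw [sum_markovWeight _ _ fun s => hU s.succ, ← Finset.sum_mul,
        sum_markovWeight _ _ fun s => hU s.succ, ← Finset.mul_sum, hU, Finset.mul_sum,
        Finset.mul_sum]
      exact Finset.sum_congr rfl fun _ _ => by ring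
    | succ s =>
      simp only [← Fin.succ_castSucc, Fin.cons_succ]
      exact ih _ (fun s => U s.succ) (fun s => hU s.succ) s

/-! ### Normalisation of the model probabilities -/

theorem sum_threshold_sub {m : ℕ} (c : Fin (m + 1) → ℝ) :
    ∑ i : Fin m, (c i.succ - c i.castSucc) = c (Fin.last m) - c 0 := by
  have h1 := Fin.sum_univ_succ c
  have h2 := Fin.sum_univ_castSucc c
  rw [Finset.sum_sub_distrib]
  linarith

theorem stdNormalCDF_top : stdNormalCDF ⊤ = 1 := by simp [stdNormalCDF]

theorem stdNormalCDF_bot : stdNormalCDF ⊥ = 0 := by simp [stdNormalCDF]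

/-- The intervals between consecutive thresholds form a partition of the real line. -/
theorem IsThreshold.sum_indicator {m : ℕ} {c : Fin (m + 1) → EReal} (hc : IsThreshold c)
    (x : ℝ) : ∑ i : Fin m, (if c i.castSucc < x ∧ (x : EReal) ≤ c i.succ then (1 : ℝ) else 0)
      = 1 := by
  -- Each interval is a difference of nested half-lines, so the sum telescopes.
  have h : ∀ i : Fin m, (if c i.castSucc < x ∧ (x : EReal) ≤ c i.succ then (1 : ℝ) else 0)
      = (if (x : EReal) ≤ c i.succ then 1 else 0)
        - (if (x : EReal) ≤ c i.castSucc then 1 else 0) := by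
    intro i
    have hi : c i.castSucc < c i.succ := hc.1 (Fin.castSucc_lt_succ)
    by_cases h1 : (x : EReal) ≤ c i.castSucc
    · simp [h1, not_lt.mpr h1, h1.trans hi.le]
    · simp [h1, not_le.mp h1]
  simp_rw [h]
  rw [sum_threshold_sub fun i => if (x : EReal) ≤ c i then (1 : ℝ) else 0,
    (hc.2 0).1 rfl, (hc.2 (Fin.last m)).2.2 rfl]
  simp

namespace LongitudinalDesign.Param

variable {𝒟 : LongitudinalDesign} {θ : Param 𝒟}

theorem sum_emission (hθ : θ.IsValid) (j : Fin 𝒟.J) (α : 𝒟.State) :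
    ∑ m, θ.emission ⟨j, m⟩ α = 1 := by
  simp only [emission, Matrix.of_apply]
  rw [sum_threshold_sub fun i => stdNormalCDF (θ.κ j i - (θ.itemPredictor j α : EReal)),
    ((hθ.1 j).2 0).1 rfl, ((hθ.1 j).2 (Fin.last _)).2.2 rfl, EReal.bot_sub, EReal.top_sub_coe,
    stdNormalCDF_top, stdNormalCDF_bot, sub_zero]

/-- In every coordinate the threshold intervals partition the line, so the boxes partition the
space: expanding the product over coordinates of sums equal to 1 gives the sum of the box
indicators. -/
theorem sum_probit (hθ : θ.IsValid) (μ : Fin 𝒟.K → ℝ) : ∑ α, θ.probit μ α = 1 := by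
  set P := multivariateGaussian (WithLp.toLp 2 μ) θ.R
  set E : 𝒟.State → Set (EuclideanSpace ℝ (Fin 𝒟.K)) := fun α =>
    {x | ∀ k, θ.γ k (α k).castSucc < (x k : EReal) ∧ (x k : EReal) ≤ θ.γ k (α k).succ}
  have hE : ∀ α, MeasurableSet (E α) := fun α => by
    have hm : ∀ k, Measurable fun x : EuclideanSpace ℝ (Fin 𝒟.K) => (x k : EReal) := fun k =>
      measurable_coe_real_ereal.comp (by fun_prop)
    exact measurableSet_setOfPred.mpr (Measurable.forall fun k => Measurable.and
      (measurableSet_setOfPred.mp (measurableSet_lt measurable_const (hm k)))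
      (measurableSet_setOfPred.mp (measurableSet_le (hm k) measurable_const)))
  have hsum : ∀ x, ∑ α, (E α).indicator (fun _ => (1 : ℝ)) x = 1 := by
    intro x
    have h1 : ∀ α : 𝒟.State, (E α).indicator (fun _ => (1 : ℝ)) x
        = ∏ k, if θ.γ k (α k).castSucc < (x k : EReal) ∧ (x k : EReal) ≤ θ.γ k (α k).succ
            then (1 : ℝ) else 0 := by
      intro α
      rw [Finset.prod_ite_zero, Finset.prod_const_one, Set.indicator_apply]
      simp [E]
    simp_rw [h1]
    rw [← Fintype.prod_sum fun k i =>
      if θ.γ k (Fin.castSucc i) < (x k : EReal) ∧ (x k : EReal) ≤ θ.γ k (Fin.succ i)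
        then (1 : ℝ) else 0]
    exact Finset.prod_eq_one fun k _ => (hθ.2.2.1 k).sum_indicator (x k)
  calc ∑ α, θ.probit μ α = ∑ α, ∫ x, (E α).indicator (fun _ => (1 : ℝ)) x ∂P :=
        Finset.sum_congr rfl fun α _ => (integral_indicator_one (hE α)).symm
    _ = ∫ x, ∑ α, (E α).indicator (fun _ => (1 : ℝ)) x ∂P :=
        (integral_finsetSum _ fun α _ => (integrable_const 1).indicator (hE α)).symm
    _ = 1 := by simp [hsum]

theorem sum_transition (hθ : θ.IsValid) (n : Fin 𝒟.N) (s : Fin 𝒟.S) (α' : 𝒟.State) :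
    ∑ α, θ.transition n s α' α = 1 :=
  sum_probit hθ _

theorem sum_pathProb (hθ : θ.IsValid) (n : Fin 𝒟.N) : ∑ a, θ.pathProb n a = 1 :=
  (sum_markovWeight (θ.initial n) (θ.transition n) (sum_transition hθ n)).trans (sum_probit hθ _)

theorem sum_pathProb_mul (n : Fin 𝒟.N) (t : Fin (𝒟.S + 1)) (f : 𝒟.State → ℝ) :
    ∑ a, θ.pathProb n a * f (a t) = ∑ α, θ.marginal n t α * f α := by
  simp only [marginal, Finset.sum_mul]
  rw [Finset.sum_comm]
  refine Finset.sum_congr rfl fun a _ => ?_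
  simp

/-- The Markov property first replaces `g` by its conditional expectation, leaving a function of a
single time point. -/
theorem sum_pathProb_mul_pair (hθ : θ.IsValid) (n : Fin 𝒟.N) (s : Fin 𝒟.S)
    (f g : 𝒟.State → ℝ) :
    ∑ a, θ.pathProb n a * (f (a s.castSucc) * g (a s.succ))
      = ∑ α', ∑ α, θ.marginal n s.castSucc α' * θ.transition n s α' α * (f α' * g α) := by
  have h := sum_markovWeight_pair (θ.initial n) (θ.transition n) (sum_transition hθ n) s f g
  refine h.trans ((sum_pathProb_mul n s.castSucc
    fun α' => f α' * ∑ α, θ.transition n s α' α * g α).trans ?_)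
  refine Finset.sum_congr rfl fun α' _ => ?_
  rw [Finset.mul_sum, Finset.mul_sum]
  exact Finset.sum_congr rfl fun α _ => by ring

/-! ### Moments of the responses -/

/-- Test functions of product form determine products of averages. -/
theorem sum_responseProb_mul (θ : Param 𝒟)
    (g : Fin 𝒟.N → Fin (𝒟.S + 1) → (j : Fin 𝒟.J) → Fin (𝒟.M j) → ℝ) :
    ∑ y, θ.responseProb y * ∏ n, ∏ t, ∏ j, g n t j (y n t j)
      = ∏ n, ∑ a, θ.pathProb n a * ∏ t, ∏ j, ∑ m, g n t j m * θ.emission ⟨j, m⟩ (a t) := by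
  have h1 : ∀ (n : Fin 𝒟.N) (a : Fin (𝒟.S + 1) → 𝒟.State),
      ∏ t, ∏ j, ∑ m, g n t j m * θ.emission ⟨j, m⟩ (a t)
        = ∑ y : Fin (𝒟.S + 1) → (j : Fin 𝒟.J) → Fin (𝒟.M j),
            ∏ t, ∏ j, g n t j (y t j) * θ.emission ⟨j, y t j⟩ (a t) := by
    intro n a
    rw [← Fintype.prod_sum fun t (z : (j : Fin 𝒟.J) → Fin (𝒟.M j)) =>
      ∏ j, g n t j (z j) * θ.emission ⟨j, z j⟩ (a t)]
    exact Finset.prod_congr rfl fun t _ =>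
      Fintype.prod_sum fun j m => g n t j m * θ.emission ⟨j, m⟩ (a t)
  simp_rw [h1, Finset.mul_sum]
  have h2 : ∀ n : Fin 𝒟.N, ∑ a, ∑ y : Fin (𝒟.S + 1) → (j : Fin 𝒟.J) → Fin (𝒟.M j),
      θ.pathProb n a * ∏ t, ∏ j, g n t j (y t j) * θ.emission ⟨j, y t j⟩ (a t)
        = ∑ y : Fin (𝒟.S + 1) → (j : Fin 𝒟.J) → Fin (𝒟.M j),
          (∑ a, θ.pathProb n a * ∏ t, ∏ j, θ.emission ⟨j, y t j⟩ (a t))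
            * ∏ t, ∏ j, g n t j (y t j) := by
    intro n
    rw [Finset.sum_comm]
    refine Finset.sum_congr rfl fun y _ => ?_
    rw [Finset.sum_mul]
    refine Finset.sum_congr rfl fun a _ => ?_
    simp only [Finset.prod_mul_distrib]
    ring
  simp_rw [h2]
  rw [Fintype.prod_sum]
  refine Finset.sum_congr rfl fun y _ => ?_
  rw [responseProb, ← Finset.prod_mul_distrib]

/-- Averages of products of entries of the emissions matrix over the latent paths. -/
theorem moment_eq_of_responseProb_eq {θ' : Param 𝒟} (hθ : θ.IsValid) (hθ' : θ'.IsValid)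
    (h : ∀ y, θ.responseProb y = θ'.responseProb y) (n : Fin 𝒟.N)
    (F : Finset (Fin (𝒟.S + 1) × 𝒟.ItemResponse))
    (hF : ∀ x ∈ F, ∀ z ∈ F, x.1 = z.1 → x.2.1 = z.2.1 → x = z) :
    ∑ a, θ.pathProb n a * ∏ x ∈ F, θ.emission x.2 (a x.1)
      = ∑ a, θ'.pathProb n a * ∏ x ∈ F, θ'.emission x.2 (a x.1) := by
  classical
  -- The test function is the indicator that respondent `n` gives the responses listed in `F`.
  -- Wherever `F` lists nothing it is 1, and that response sums out.
  let g : Fin 𝒟.N → Fin (𝒟.S + 1) → (j : Fin 𝒟.J) → Fin (𝒟.M j) → ℝ := fun n' t j m =>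
    if n' = n then (if ∀ x ∈ F, x.1 = t → x.2.1 = j → x.2 = ⟨j, m⟩ then 1 else 0) else 1
  suffices H : ∀ {θ : Param 𝒟}, θ.IsValid →
      ∑ y, θ.responseProb y * ∏ n, ∏ t, ∏ j, g n t j (y n t j)
        = ∑ a, θ.pathProb n a * ∏ x ∈ F, θ.emission x.2 (a x.1) by
    rw [← H hθ, ← H hθ']
    simp_rw [h]
  intro θ hθ
  rw [sum_responseProb_mul, Finset.prod_eq_single n]
  · refine Finset.sum_congr rfl fun a _ => ?_
    congr 1
    have h1 : ∀ t j, ∑ m, g n t j m * θ.emission ⟨j, m⟩ (a t)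
        -- Spreading the value over `F` allows the products over `t` and `j` to be carried out for
        -- each `x` separately; by `hF` at most one factor differs from 1.
        = ∏ x ∈ F, if t = x.1 then (if j = x.2.1 then θ.emission x.2 (a x.1) else 1) else 1 := by
      intro t j
      by_cases hx : ∃ x ∈ F, x.1 = t ∧ x.2.1 = j
      · obtain ⟨⟨_, ⟨_, m₀⟩⟩, hxF, rfl, rfl⟩ := hx
        dsimp only at hF ⊢
        rename_i t j
        rw [Finset.prod_eq_single_of_mem _ hxF]
        · rw [if_pos rfl, if_pos rfl, Finset.sum_eq_single m₀]
          · rw [show g n t j m₀ = 1 by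
              simp only [g, if_true]
              exact if_pos fun z hz h1 h2 => by rw [hF z hz _ hxF h1 h2], one_mul]
          · intro m _ hm
            rw [show g n t j m = 0 by
              simp only [g, if_true]
              refine if_neg fun hall => hm ?_
              simpa using (hall _ hxF rfl rfl).symm, zero_mul]
          · simp
        · intro z hz hne
          split_ifs with h1 h2
          · exact absurd (hF z hz _ hxF h1.symm h2.symm) hne
          · rfl
          · rfl
      · push Not at hx
        rw [Finset.prod_eq_one]
        · rw [← sum_emission hθ j (a t)]
          refine Finset.sum_congr rfl fun m _ => ?_
          rw [show g n t j m = 1 by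
            simp only [g, if_true]
            exact if_pos fun z hz h1 h2 => absurd h2 (hx z hz h1), one_mul]
        · intro z hz
          split_ifs with h1 h2
          · exact absurd h2.symm (hx z hz h1.symm)
          · rfl
          · rfl
    simp_rw [h1]
    rw [Finset.prod_congr rfl fun t _ => Finset.prod_comm, Finset.prod_comm]
    refine Finset.prod_congr rfl fun x _ => ?_
    rw [Finset.prod_eq_single_of_mem x.1 (Finset.mem_univ _) fun t _ ht => by simp [ht]]
    simp
  · intro n' _ hn'
    simp only [g, if_neg hn', one_mul, sum_emission hθ, Finset.prod_const_one, mul_one]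
    exact sum_pathProb hθ n'
  · simp

theorem sum_marginal_mul_prod_emission_eq {θ' : Param 𝒟} (hθ : θ.IsValid) (hθ' : θ'.IsValid)
    (h : ∀ y, θ.responseProb y = θ'.responseProb y) (n : Fin 𝒟.N) (t : Fin (𝒟.S + 1))
    (F : Finset 𝒟.ItemResponse) (hF : ∀ x ∈ F, ∀ z ∈ F, x.1 = z.1 → x = z) :
    ∑ α, θ.marginal n t α * ∏ r ∈ F, θ.emission r α
      = ∑ α, θ'.marginal n t α * ∏ r ∈ F, θ'.emission r α := by
  have := moment_eq_of_responseProb_eq hθ hθ' h n (F.image fun r => (t, r)) (by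
    simp only [Finset.mem_image]
    rintro _ ⟨x, hx, rfl⟩ _ ⟨z, hz, rfl⟩ _ h2
    rw [hF x hx z hz h2])
  simp only [Finset.prod_image fun x _ z _ (hxz : (t, x) = (t, z)) => (Prod.mk.inj hxz).2] at this
  rwa [sum_pathProb_mul n t fun α => ∏ r ∈ F, θ.emission r α,
    sum_pathProb_mul n t fun α => ∏ r ∈ F, θ'.emission r α] at this

/-- The responses `q` and `r` may belong to the same item, since they are given at different times;
hence one full-rank block serves on both sides of the joint weights. -/
theorem sum_marginal_mul_transition_eq {θ' : Param 𝒟} (hθ : θ.IsValid) (hθ' : θ'.IsValid)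
    (h : ∀ y, θ.responseProb y = θ'.responseProb y) (n : Fin 𝒟.N) (s : Fin 𝒟.S)
    (q r : 𝒟.ItemResponse) :
    ∑ α', ∑ α, θ.marginal n s.castSucc α' * θ.transition n s α' α
        * (θ.emission q α' * θ.emission r α)
      = ∑ α', ∑ α, θ'.marginal n s.castSucc α' * θ'.transition n s α' α
        * (θ'.emission q α' * θ'.emission r α) := by
  have hne : s.castSucc ≠ s.succ := Fin.castSucc_lt_succ.ne
  have := moment_eq_of_responseProb_eq hθ hθ' h n {(s.castSucc, q), (s.succ, r)} (by
    simp only [Finset.mem_insert, Finset.mem_singleton]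
    rintro x (rfl | rfl) z (rfl | rfl) h1 _
    · rfl
    · exact absurd h1 hne
    · exact absurd h1.symm hne
    · rfl)
  have hmem : (s.castSucc, q) ∉ ({(s.succ, r)} : Finset (Fin (𝒟.S + 1) × 𝒟.ItemResponse)) := by
    simp [hne]
  simp only [Finset.prod_insert hmem, Finset.prod_singleton] at this
  rwa [sum_pathProb_mul_pair hθ n s (θ.emission q) (θ.emission r),
    sum_pathProb_mul_pair hθ' n s (θ'.emission q) (θ'.emission r)] at this

/-! ### Recovering emissions, marginals and joint weights -/

/-- A block of the emissions matrix of full rank has a left inverse. -/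
theorem exists_left_inverse_emissionBlock {I : Finset (Fin 𝒟.J)}
    (hI : (θ.emissionBlock I).rank = 𝒟.L ^ 𝒟.K) :
    ∃ C : Matrix 𝒟.State {r : 𝒟.ItemResponse // r.1 ∈ I} ℝ, C * θ.emissionBlock I = 1 :=
  exists_left_inverse_of_rank_eq_card _ (by rw [hI]; simp)

/-- At a single time point, the emissions matrix and the marginal probabilities are identified up
to a permutation of the latent states. -/
theorem exists_perm_emission_marginal {θ' : Param 𝒟} (hθ : θ.IsValid) (hθ' : θ'.IsValid)
    (h1 : θ.C1) (h3 : θ.C3) (h : ∀ y, θ.responseProb y = θ'.responseProb y) (n : Fin 𝒟.N)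
    (t : Fin (𝒟.S + 1)) :
    ∃ σ : Equiv.Perm 𝒟.State, (∀ α, θ'.marginal n t α = θ.marginal n t (σ α)) ∧
      ∀ r α, θ'.emission r α = θ.emission r (σ α) := by
  obtain ⟨I₁, I₂, I₃, h₁₂, h₁₃, h₂₃, r₁, r₂, r₃⟩ := h3
  obtain ⟨C₁, hC₁⟩ := exists_left_inverse_emissionBlock r₁
  obtain ⟨C₂, hC₂⟩ := exists_left_inverse_emissionBlock r₂
  obtain ⟨C₃, hC₃⟩ := exists_left_inverse_emissionBlock r₃
  have m₁ : ∀ q, ∑ α, θ.marginal n t α * θ.emission q α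
      = ∑ α, θ'.marginal n t α * θ'.emission q α := fun q => by
    simpa using sum_marginal_mul_prod_emission_eq hθ hθ' h n t {q} (by simp)
  have m₂ : ∀ q r, q.1 ≠ r.1 → ∑ α, θ.marginal n t α * (θ.emission q α * θ.emission r α)
      = ∑ α, θ'.marginal n t α * (θ'.emission q α * θ'.emission r α) := fun q r hqr => by
    have hmem : q ∉ ({r} : Finset 𝒟.ItemResponse) := by
      simpa using fun e => hqr (congrArg Sigma.fst e)
    simpa only [Finset.prod_insert hmem, Finset.prod_singleton] using
      sum_marginal_mul_prod_emission_eq hθ hθ' h n t {q, r} (by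
        simp only [Finset.mem_insert, Finset.mem_singleton]
        rintro x (rfl | rfl) z (rfl | rfl) e
        exacts [rfl, absurd e hqr, absurd e.symm hqr, rfl])
  have m₃ : ∀ p q r, p.1 ≠ q.1 → p.1 ≠ r.1 → q.1 ≠ r.1 →
      ∑ α, θ.marginal n t α * (θ.emission p α * (θ.emission q α * θ.emission r α))
      = ∑ α, θ'.marginal n t α * (θ'.emission p α * (θ'.emission q α * θ'.emission r α)) :=
    fun p q r hpq hpr hqr => by
    have hmem : q ∉ ({r} : Finset 𝒟.ItemResponse) := by
      simpa using fun e => hqr (congrArg Sigma.fst e)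
    have hmem' : p ∉ ({q, r} : Finset 𝒟.ItemResponse) := by
      simp only [Finset.mem_insert, Finset.mem_singleton]
      rintro (e | e)
      exacts [hpq (congrArg Sigma.fst e), hpr (congrArg Sigma.fst e)]
    simpa only [Finset.prod_insert hmem', Finset.prod_insert hmem, Finset.prod_singleton] using
      sum_marginal_mul_prod_emission_eq hθ hθ' h n t {p, q, r} (by
        simp only [Finset.mem_insert, Finset.mem_singleton]
        rintro x (rfl | rfl | rfl) z (rfl | rfl | rfl) e
        exacts [rfl, absurd e hpq, absurd e hpr, absurd e.symm hpq, rfl, absurd e hqr,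
          absurd e.symm hpr, absurd e.symm hqr, rfl])
  have ne_of_disjoint : ∀ {I I' : Finset (Fin 𝒟.J)}, Disjoint I I' → ∀ {i i'}, i ∈ I → i' ∈ I' →
      i ≠ i' := fun hd _ _ hi hi' e => Finset.disjoint_left.mp hd hi (e ▸ hi')
  obtain ⟨σ, hσ, hu⟩ := exists_perm_of_three_way (A₁' := θ'.emissionBlock I₁)
    (A₂' := θ'.emissionBlock I₂) (A₃ := θ.emissionBlock I₃) (A₃' := θ'.emissionBlock I₃)
    (p' := θ'.marginal n t) hC₁ hC₂
    (fun a b => column_injective_of_left_inverse hC₃) (h1 n t)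
    (fun r => m₁ r) (fun r => m₁ r) (fun r s => m₂ r s (ne_of_disjoint h₁₂ r.2 s.2))
    (fun r s q => m₃ r s q (ne_of_disjoint h₁₂ r.2 s.2) (ne_of_disjoint h₁₃ r.2 q.2)
      (ne_of_disjoint h₂₃ s.2 q.2))
  refine ⟨σ, hσ, fun r => hu (θ.emission r) (θ'.emission r) ?_⟩
  -- Two-way moments need distinct items, so row `r` is tested against a block that does not contain
  -- its item.
  by_cases hr : r.1 ∈ I₁
  · exact Or.inr fun s => m₂ r s (ne_of_disjoint h₁₂ hr s.2)
  · exact Or.inl fun s => m₂ r s fun e => hr (e ▸ s.2)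

/-- Joint weights of pairs of latent states are determined by their averages over the columns of a
matrix with a left inverse. -/
theorem weight_eq_of_sum_mul_eq {R A : Type*} [Fintype R] [Fintype A] [DecidableEq A]
    {B : Matrix R A ℝ} {C : Matrix A R ℝ} (hC : C * B = 1) {w w' : Matrix A A ℝ}
    (h : ∀ q r, ∑ a, ∑ b, w a b * (B q a * B r b) = ∑ a, ∑ b, w' a b * (B q a * B r b)) :
    w = w' := by
  have e : ∀ (w : Matrix A A ℝ) q r, (B * w * B.transpose) q r
      = ∑ a, ∑ b, w a b * (B q a * B r b) := by
    intro w q r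
    simp only [Matrix.mul_apply, Matrix.transpose_apply, Finset.sum_mul]
    rw [Finset.sum_comm]
    exact Finset.sum_congr rfl fun _ _ => Finset.sum_congr rfl fun _ _ => by ring
  have hB : B * w * B.transpose = B * w' * B.transpose := by
    ext q r
    rw [e, e, h]
  have hC' : B.transpose * C.transpose = 1 := by
    rw [← Matrix.transpose_mul, hC, Matrix.transpose_one]
  have key : ∀ w : Matrix A A ℝ, C * (B * w * B.transpose) * C.transpose = w := by
    intro w
    rw [Matrix.mul_assoc, Matrix.mul_assoc (B * w), hC', Matrix.mul_one, ← Matrix.mul_assoc, hC,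
      Matrix.one_mul]
  rw [← key w, hB, key]

end LongitudinalDesign.Param

/-! ### The identifiability theorem -/

open LongitudinalDesign LongitudinalDesign.Param

theorem mainTheorem3 (𝒟 : LongitudinalDesign) (hN : 0 < 𝒟.N) :
    StrictlyIdentifiable 𝒟.paramSpace (fun θ => θ.triple) 𝒟.labelSwap
      (fun θ y => θ.responseProb y) := by
  rintro θ ⟨hθ, h1, -, h3, -⟩ θ' ⟨hθ', -, -, -, -⟩ h
  have hex := exists_perm_emission_marginal hθ hθ' h1 h3 h
  obtain ⟨I, -, -, -, -, -, rI, -, -⟩ := h3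
  obtain ⟨C, hC⟩ := exists_left_inverse_emissionBlock rI
  -- Any respondent and time point may supply the common permutation.
  obtain ⟨σ, -, hB⟩ := hex ⟨0, hN⟩ 0
  have hP : ∀ n t α, θ'.marginal n t α = θ.marginal n t (σ α) := by
    intro n t α
    obtain ⟨τ, hτ, hBτ⟩ := hex n t
    rw [hτ α, column_injective_of_left_inverse hC (a := τ α) (b := σ α) fun r =>
      (hBτ r.1 α).symm.trans (hB r.1 α)]
  refine ⟨σ, ?_⟩
  ext
  · exact hB _ _
  · rename_i n s α' α
    change θ'.transition n s α' α = θ.transition n s (σ α') (σ α)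
    let w : Matrix 𝒟.State 𝒟.State ℝ := Matrix.of fun a b =>
      θ.marginal n s.castSucc a * θ.transition n s a b
    -- The second joint weights are relabelled along `σ`, so that both sides are averaged against
    -- the columns of the same block of `B`.
    let w' : Matrix 𝒟.State 𝒟.State ℝ := Matrix.of fun a b =>
      θ'.marginal n s.castSucc (σ.symm a) * θ'.transition n s (σ.symm a) (σ.symm b)
    have hw : w = w' := weight_eq_of_sum_mul_eq hC fun q r => by
      refine (sum_marginal_mul_transition_eq hθ hθ' h n s q.1 r.1).trans ?_
      exact Fintype.sum_equiv σ _ _ fun a => Fintype.sum_equiv σ _ _ fun b => by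
        simp [w', emissionBlock, hB]
    have := congrFun (congrFun hw (σ α')) (σ α)
    simp only [w, w', Matrix.of_apply, Equiv.symm_apply_apply, hP] at this
    exact (mul_left_cancel₀ (h1 n _ _).ne' this).symm
  · exact hP _ _ _
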